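/- For $n\ge 0$ let the alternatives be $1,\dots,n$. A *domain* is a set of linear orders on them; it is a *Condorcet domain* if every profile of an odd number of voters with preferences in the domain has a transitive majority relation, and a *peak-pit domain* if in every triple of alternatives some alternative of the triple is never ranked last among the three by an order of the domain, or some alternative of the triple is never ranked first among the three. Let $f(n)$ (resp. $h(n)$) be the maximum size of a Condorcet domain (resp. peak-pit Condorcet domain) on $n$ alternatives. Let $A_n=\{2,4,6,\dots,n-2+(n \bmod 2)\}$ (empty for $n\le 2$). The *even $1N33N1$-alternating domain* consists of all linear orders such that for all $1\le i<j<k\le n$: if $j\in A_n$, then $i$ is not ranked last among $i,j,k$; if $j\notin A_n$, then $k$ is not ranked first among $i,j,k$. Let $a(n)$ be its size. For real sequences $u$ and $v$, $u(n)\in\Omega(v(n))$ means that there is $c>0$ with $u(n)\ge c\,v(n)$ for all sufficiently large $n$. Then: 1. $a(n)\sim\frac{\sqrt2}{4}\left(\sqrt{2+2\sqrt2}\right)^n$ as $n\to\infty$ through even $n$. 2. $a(n)\sim\frac{\sqrt{\sqrt2-1}}{2}\left(\sqrt{2+2\sqrt2}\right)^n$ as $n\to\infty$ through odd $n$. 3.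 $a(n)=2a(n-1)$ for every odd $n\ge3$. 4. With $w(m)=a(2m)$ and $C_k$ the $k$-th Catalan number, $w(0)=1$ and $w(m)=\sum_{k=1}^m C_{k+1}\,w(m-k)$ for all $m\ge1$. 5. $f(n)$ and $h(n)$ are both in $\Omega\left(\left(\sqrt{2+2\sqrt2}\right)^n\right)$, and hence both in $\Omega(2.1973^n)$. -/

import Mathlib

open Filter Asymptotics Topology

namespace VotingDomain

/-- A linear (preference) order on the `n` alternatives `Fin n`, given by its rank function:
`r x` is the position of the alternative `x`, so `r x < r y` means that `x` is ranked above
(preferred to) `y`, and position `0` is the best one. -/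
abbrev Pref (n : ℕ) : Type := Equiv.Perm (Fin n)

/-- A domain: a set of linear orders on `n` alternatives. -/
abbrev Domain (n : ℕ) : Type := Set (Pref n)

/-- The (strict) majority relation of a profile `P` of `m` agents: more agents rank `x` above `y`
than rank `y` above `x`. -/
def Majority {n m : ℕ} (P : Fin m → Pref n) (x y : Fin n) : Prop :=
  (Finset.univ.filter fun i => P i y < P i x).card <
    (Finset.univ.filter fun i => P i x < P i y).card

/-- `D` is a Condorcet domain: every profile of an odd number of agents with preferences in `D`
has a transitive majority relation. -/
def IsCondorcet {n : ℕ} (D : Domain n) : Prop :=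
  ∀ (m : ℕ) (P : Fin m → Pref n), Odd m → (∀ i, P i ∈ D) →
    ∀ x y z : Fin n, Majority P x y → Majority P y z → Majority P x z

/-- The place (first, second, third, ... counted from `1`) of the alternative `x` in the
restriction of the order `r` to the set `S` of alternatives. -/
def placeIn {n : ℕ} (r : Pref n) (S : Finset (Fin n)) (x : Fin n) : ℕ :=
  (S.filter fun y => r y < r x).card + 1

/-- Never condition: in the restriction to `S` of an order of `D`, the alternative `x` never
takes place `p`. -/
def Never {n : ℕ} (D : Domain n) (S : Finset (Fin n)) (x : Fin n) (p : ℕ) : Prop :=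
  ∀ r ∈ D, placeIn r S x ≠ p

/-- `D` is a peak-pit domain: for each triple, some alternative of the triple is never last
(single-peaked restriction) or some alternative of the triple is never first (single-dipped
restriction). -/
def IsPeakPit {n : ℕ} (D : Domain n) : Prop :=
  ∀ S : Finset (Fin n), S.card = 3 → (∃ x ∈ S, Never D S x 3) ∨ (∃ x ∈ S, Never D S x 1)

/-- The largest size of a Condorcet domain on `n` alternatives. -/
noncomputable def maxCondorcet (n : ℕ) : ℕ :=
  sSup {s : ℕ | ∃ D : Domain n, IsCondorcet D ∧ D.ncard = s}

/-- The largest size of a peak-pit Condorcet domain on `n` alternatives. -/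
noncomputable def maxPeakPit (n : ℕ) : ℕ :=
  sSup {s : ℕ | ∃ D : Domain n, IsCondorcet D ∧ IsPeakPit D ∧ D.ncard = s}

/-- The domain of the set-alternating scheme generated by `A`: all orders that satisfy, for all
`i < j < k`, the condition `1N3` (`i` is not last among `i, j, k`) if `j` belongs to `A`, and the
condition `3N1` (`k` is not first among `i, j, k`) otherwise. The alternatives are labelled
`1, ..., n`, so the label of `j : Fin n` is `j + 1`. -/
def setAlternating (n : ℕ) (A : Set ℕ) : Domain n :=
  {r | ∀ i j k : Fin n, i < j → j < k →
    (((j : ℕ) + 1 ∈ A → placeIn r {i, j, k} i ≠ 3) ∧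
      ((j : ℕ) + 1 ∉ A → placeIn r {i, j, k} k ≠ 1))}

/-- The set `{2, 4, 6, ..., n - 2 + (n mod 2)}`. -/
def evenSet (n : ℕ) : Set ℕ := {j | Even j ∧ 2 ≤ j ∧ j + 2 ≤ n + n % 2}

/-- The size `a(n)` of the even `1N33N1`-alternating domain on `n` alternatives. -/
noncomputable def evenSize (n : ℕ) : ℕ := (setAlternating n (evenSet n)).ncard

/-- `u ∈ Ω(v)`: `u n` is eventually at least a fixed positive multiple of `v n`. -/
def InOmega (u v : ℕ → ℝ) : Prop := ∃ c : ℝ, 0 < c ∧ ∀ᶠ n in atTop, c * v n ≤ u n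

theorem isCondorcet_empty (n : ℕ) : IsCondorcet (∅ : Domain n) := by
  intro m P hm hP
  obtain ⟨k, rfl⟩ := hm
  exact (hP 0).elim

theorem isPeakPit_empty (n : ℕ) : IsPeakPit (∅ : Domain n) := by
  intro S hS
  obtain ⟨x, hx⟩ := Finset.card_pos.mp (by omega : 0 < S.card)
  exact Or.inl ⟨x, hx, fun r hr => hr.elim⟩

theorem ncard_le_factorial {n : ℕ} (D : Domain n) : D.ncard ≤ n.factorial := by
  have h := Set.ncard_le_card D
  simpa [Nat.card_eq_fintype_card, Fintype.card_perm] using h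

/-- The maximum over all Condorcet domains is attained. -/
theorem isGreatest_maxCondorcet (n : ℕ) :
    IsGreatest {s : ℕ | ∃ D : Domain n, IsCondorcet D ∧ D.ncard = s} (maxCondorcet n) := by
  have hb : BddAbove {s : ℕ | ∃ D : Domain n, IsCondorcet D ∧ D.ncard = s} :=
    ⟨n.factorial, by rintro s ⟨D, -, rfl⟩; exact ncard_le_factorial D⟩
  exact ⟨Nat.sSup_mem ⟨_, ∅, isCondorcet_empty n, rfl⟩ hb, fun s hs => le_csSup hb hs⟩

/-- The maximum over all peak-pit Condorcet domains is attained. -/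
theorem isGreatest_maxPeakPit (n : ℕ) :
    IsGreatest {s : ℕ | ∃ D : Domain n, IsCondorcet D ∧ IsPeakPit D ∧ D.ncard = s}
      (maxPeakPit n) := by
  have hb : BddAbove {s : ℕ | ∃ D : Domain n, IsCondorcet D ∧ IsPeakPit D ∧ D.ncard = s} :=
    ⟨n.factorial, by rintro s ⟨D, -, -, rfl⟩; exact ncard_le_factorial D⟩
  exact ⟨Nat.sSup_mem ⟨_, ∅, isCondorcet_empty n, isPeakPit_empty n, rfl⟩ hb,
    fun s hs => le_csSup hb hs⟩

end VotingDomain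

open VotingDomain

/-!
The orders of the even alternating domain on `n + 1` alternatives arise from those on `n`
alternatives by inserting the largest alternative (`alternating_insertLast`,
`insertLast_bijective`). The admissible positions form a final segment (`Legal.mono`), and their
number after an insertion depends only on their number before, on the position chosen and on the
parity of the inserted alternative. Let the slack be the number of admissible positions other than
the last one. With zero-based labels, inserting an even alternative into an order of slack `t` gives
orders of slacks `1, 1, 2, ..., t`, and inserting an odd one into an order of slack `s` gives one
order of slack `s + 1` and `s` orders of slack `0` (`slackSum_succ_of_even`, `slackSum_succ_of_odd`).
The doubling for odd `n` is immediate from this (`evenSize_odd`).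

Let `c = 1 + X c ^ 2` be the Catalan series. The generating functions, over the number of pairs of
insertions, of the descendants of an order of slack `t` solve a linear system in `t`, solved by
`((c ^ t - 1) / X + 1 - t) * W` with `W = 1 / (2 - c ^ 2)` (`descendantSeries_eq`). So `W` is the
generating function of the sizes for even `n`; since `X c ^ 2 = c - 1`, the coefficients of `c ^ 2`
are shifted Catalan numbers, which is the recurrence (`evenSize_even_eq_sum_catalan`).

Eliminating `c ^ 2` from the denominator gives `(1 - 4X - 4X²) W = 1 - X - 2X² - X c`
(`evenSize_linear_recurrence`). The dominant pole `x = (√2 - 1) / 2` is smaller than the radius of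
convergence `1/4` of `c`, and `c(x) = √2` (`hasSum_catalan`), so the sizes are asymptotic to
`√2 / 4 * x ^ (-m)` (`tendsto_of_linear_recurrence`), and `1 / x = 2 + 2√2`.

Finally, a majority cycle would produce three voters who together rank each alternative of some
triple both first and last, so peak-pit domains are Condorcet domains (`IsPeakPit.isCondorcet`); the
alternating domains are peak-pit, and their sizes are lower bounds for both maxima.
-/

namespace VotingDomain

/-! ### Alternating orders -/

/-- An order is *alternating* if, whenever `i < j < k` and `k` is ranked above `i`, an odd `j` is
ranked below both of them and an even `j` above both. Parity refers to the zero-based labels of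
`Fin n`, so an odd `j` has an even label in `1, ..., n`. -/
def Alternating {n : ℕ} (r : Pref n) : Prop :=
  ∀ i j k : Fin n, i < j → j < k → r k < r i →
    (Odd (j : ℕ) → r i < r j) ∧ (Even (j : ℕ) → r j < r k)

theorem placeIn_triple_eq_three {n : ℕ} (r : Pref n) {x y z : Fin n} (hyz : y ≠ z) :
    placeIn r {x, y, z} x = 3 ↔ r y < r x ∧ r z < r x := by
  unfold placeIn
  by_cases h1 : r y < r x <;> by_cases h2 : r z < r x <;>
    simp [Finset.filter_insert, Finset.filter_singleton, h1, h2, hyz]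

theorem placeIn_eq_one {n : ℕ} (r : Pref n) (S : Finset (Fin n)) (x : Fin n) :
    placeIn r S x = 1 ↔ ∀ y ∈ S, r x ≤ r y := by
  simp [placeIn, Finset.filter_eq_empty_iff]

/-- The members of the even alternating domain are the alternating orders: the upper end of
`evenSet n` plays no role, since a middle alternative of a triple has label at most `n - 1`. -/
theorem mem_setAlternating_evenSet {n : ℕ} (r : Pref n) :
    r ∈ setAlternating n (evenSet n) ↔ Alternating r := by
  unfold setAlternating Alternating
  simp only [Set.mem_ofPred_eq]
  refine forall_congr' fun i => forall_congr' fun j => forall_congr' fun k =>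
    forall_congr' fun hij => forall_congr' fun hjk => ?_
  have hmem : (j : ℕ) + 1 ∈ evenSet n ↔ Odd (j : ℕ) := by
    have := k.isLt
    have h1 : (i : ℕ) < j := hij
    have h2 : (j : ℕ) < k := hjk
    simp only [evenSet, Set.mem_ofPred_eq, Nat.even_iff, Nat.odd_iff]
    omega
  have hij' : r i ≠ r j := fun h => hij.ne (r.injective h)
  have hjk' : r j ≠ r k := fun h => hjk.ne (r.injective h)
  have hik' : r i ≠ r k := fun h => (hij.trans hjk).ne (r.injective h)
  rw [hmem, Ne, placeIn_triple_eq_three r hjk.ne, Ne, placeIn_eq_one,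
    Nat.not_odd_iff_even]
  simp only [Finset.mem_insert, Finset.mem_singleton, forall_eq_or_imp, forall_eq]
  rcases Nat.even_or_odd (j : ℕ) with h | h
  · have h' := Nat.not_odd_iff_even.mpr h
    simp only [h, h', false_imp_iff, true_imp_iff, true_and]
    grind
  · have h' := Nat.not_even_iff_odd.mpr h
    simp only [h, h', false_imp_iff, true_imp_iff, and_true]
    grind

/-! ### Insertion of the next alternative -/

/-- The order on `n + 1` alternatives obtained from `r` by inserting the new alternative `n` at
position `p`. -/
def insertLast {n : ℕ} (p : Fin (n + 1)) (r : Pref n) : Pref (n + 1) :=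
  (finSuccEquivLast.trans r.optionCongr).trans (finSuccEquiv' p).symm

@[simp] theorem insertLast_last {n : ℕ} (p : Fin (n + 1)) (r : Pref n) :
    insertLast p r (Fin.last n) = p := by
  simp [insertLast]

@[simp] theorem insertLast_castSucc {n : ℕ} (p : Fin (n + 1)) (r : Pref n) (x : Fin n) :
    insertLast p r x.castSucc = p.succAbove (r x) := by
  simp [insertLast]

theorem val_insertLast_castSucc {n : ℕ} (p : Fin (n + 1)) (r : Pref n) (x : Fin n) :
    (insertLast p r x.castSucc : ℕ) = if (r x : ℕ) < p then (r x : ℕ) else r x + 1 := by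
  rw [insertLast_castSucc, Fin.succAbove]
  split_ifs with h h' h' <;> simp_all [Fin.lt_def]

/-- Every order on `n + 1` alternatives arises by exactly one insertion into exactly one order. -/
theorem insertLast_bijective (n : ℕ) :
    Function.Bijective (fun x : Fin (n + 1) × Pref n => insertLast x.1 x.2) := by
  rw [Fintype.bijective_iff_injective_and_card]
  constructor
  · rintro ⟨p, r⟩ ⟨q, s⟩ h
    simp only at h
    have hpq : p = q := by simpa using congrArg (fun e => e (Fin.last n)) h
    subst hpq
    refine Prod.ext rfl (Equiv.ext fun x => ?_)
    simpa using congrArg (fun e => e x.castSucc) h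
  · simp [Fintype.card_perm, Nat.factorial_succ]

/-- The condition under which inserting the next alternative at position `p` creates no forbidden
triple: it constrains the alternatives that will be ranked below the new one. -/
def Legal {n : ℕ} (r : Pref n) (p : ℕ) : Prop :=
  ∀ i j : Fin n, i < j → p ≤ r i →
    (Odd (j : ℕ) → r i < r j) ∧ (Even (j : ℕ) → (r j : ℕ) < p)

/-- The legal positions form a final segment, hence are described by their number. -/
theorem Legal.mono {n : ℕ} {r : Pref n} {p q : ℕ} (h : Legal r p) (hpq : p ≤ q) : Legal r q :=
  fun i j hij hi => ⟨(h i j hij (hpq.trans hi)).1,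
    fun hj => ((h i j hij (hpq.trans hi)).2 hj).trans_le hpq⟩

theorem legal_self {n : ℕ} (r : Pref n) : Legal r n :=
  fun i _ _ hi => absurd (r i).isLt (not_lt.mpr hi)

theorem alternating_insertLast {n : ℕ} (p : Fin (n + 1)) (r : Pref n) :
    Alternating (insertLast p r) ↔ Alternating r ∧ Legal r p := by
  constructor
  · refine fun h => ⟨fun i j k hij hjk hki => ?_, fun i j hij hi => ?_⟩
    · have := h i.castSucc j.castSucc k.castSucc hij hjk
      simpa [Fin.succAbove_lt_succAbove_iff, hki] using this
    · have := h i.castSucc j.castSucc (Fin.last n) hij (Fin.castSucc_lt_last j)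
      simp only [Fin.lt_def, val_insertLast_castSucc, insertLast_last, Fin.val_castSucc] at this ⊢
      grind
  · rintro ⟨h, hl⟩ i j k hij hjk hki
    obtain ⟨j, rfl⟩ := Fin.exists_castSucc_eq.mpr (hjk.trans_le (Fin.le_last k)).ne
    obtain ⟨i, rfl⟩ := Fin.exists_castSucc_eq.mpr (hij.trans (Fin.castSucc_lt_last j)).ne
    induction k using Fin.lastCases with
    | last =>
      have := hl i j hij
      simp only [Fin.lt_def, val_insertLast_castSucc, insertLast_last, Fin.val_castSucc]
        at this hki ⊢
      grind
    | cast k =>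
      have := h i j k hij hjk
      simp only [insertLast_castSucc, Fin.succAbove_lt_succAbove_iff, Fin.val_castSucc] at hki ⊢
      exact this hki

open Classical in
/-- The number of legal positions, other than the last one, for the next alternative. -/
noncomputable def slack {n : ℕ} (r : Pref n) : ℕ := n - Nat.find ⟨n, legal_self r⟩

theorem slack_le {n : ℕ} (r : Pref n) : slack r ≤ n := Nat.sub_le _ _

theorem legal_iff {n : ℕ} (r : Pref n) (p : ℕ) : Legal r p ↔ n ≤ p + slack r := by
  classical
  have hle : Nat.find ⟨n, legal_self r⟩ ≤ n := Nat.find_min' _ (legal_self r)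
  unfold slack
  constructor
  · intro h
    have : Nat.find ⟨n, legal_self r⟩ ≤ p := Nat.find_min' _ h
    omega
  · intro h
    exact (Nat.find_spec ⟨n, legal_self r⟩).mono (by omega)

theorem slack_eq_of_forall {n s : ℕ} (r : Pref n) (hs : s ≤ n)
    (h : ∀ p ≤ n, Legal r p ↔ n ≤ p + s) : slack r = s := by
  have h1 := (h (n - s) (by omega)).mpr (by omega)
  rw [legal_iff] at h1
  have h2 := (h (n - slack r) (by omega)).mp ((legal_iff r _).mpr (by have := slack_le r; omega))
  have := slack_le r
  omega

/-- Legality after an insertion, split into the triples that avoid the inserted alternative and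
those that contain it. -/
theorem legal_insertLast {n : ℕ} (p : Fin (n + 1)) (r : Pref n) (q : ℕ) :
    Legal (insertLast p r) q ↔
      (∀ i j : Fin n, i < j → q ≤ insertLast p r i.castSucc →
        (Odd (j : ℕ) → r i < r j) ∧ (Even (j : ℕ) → (insertLast p r j.castSucc : ℕ) < q)) ∧
      ∀ i : Fin n, q ≤ insertLast p r i.castSucc →
        (Odd n → (r i : ℕ) < p) ∧ (Even n → (p : ℕ) < q) := by
  constructor
  · refine fun h => ⟨fun i j hij hi => ?_, fun i hi => ?_⟩
    · have := h i.castSucc j.castSucc hij hi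
      simpa [Fin.succAbove_lt_succAbove_iff] using this
    · have := h i.castSucc (Fin.last n) (Fin.castSucc_lt_last i) hi
      simp only [Fin.lt_def, val_insertLast_castSucc, insertLast_last, Fin.val_last] at this
      grind
  · rintro ⟨h, hl⟩ i j hij hi
    obtain ⟨i, rfl⟩ := Fin.exists_castSucc_eq.mpr (hij.trans_le (Fin.le_last j)).ne
    induction j using Fin.lastCases with
    | last =>
      have := hl i hi
      simp only [Fin.lt_def, val_insertLast_castSucc, insertLast_last, Fin.val_last]
      grind
    | cast j =>
      have := h i j hij hi
      simpa [Fin.succAbove_lt_succAbove_iff] using this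

theorem exists_rank_eq {n : ℕ} (r : Pref n) {a : ℕ} (ha : a < n) : ∃ i, (r i : ℕ) = a :=
  ⟨r.symm ⟨a, ha⟩, by simp⟩

/-- An even `n` (zero-based label) has to be ranked above the following alternative as soon as an
older alternative is ranked below the latter. If `n` is ranked last, this leaves only the last two
positions. -/
theorem slack_insertLast_even_last {n : ℕ} (hn : Even n) (r : Pref n) :
    slack (insertLast (Fin.last n) r) = 1 := by
  refine slack_eq_of_forall _ (by omega) fun q hq => ?_
  rw [legal_insertLast]
  have hn' := Nat.not_odd_iff_even.mpr hn
  simp only [val_insertLast_castSucc, Fin.val_last, Fin.is_lt, if_true]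
  constructor
  · rintro ⟨-, h⟩
    by_contra hlt
    obtain ⟨i, hi⟩ := exists_rank_eq r (a := n - 1) (by omega)
    have := (h i (by omega)).2 hn
    omega
  · intro h
    refine ⟨fun i j _ hi => ?_, fun i hi => ?_⟩ <;> have := (r i).isLt <;> omega

/-- If an even `n` is not ranked last, the following alternative may take exactly the positions
below `n`: there the older alternatives raise no objection, since the position of `n` was legal. -/
theorem slack_insertLast_even {n : ℕ} (hn : Even n) {p : Fin (n + 1)} (hp : (p : ℕ) < n)
    {r : Pref n} (h : Legal r p) : slack (insertLast p r) = n - p := by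
  refine slack_eq_of_forall _ (by omega) fun q hq => ?_
  rw [legal_insertLast]
  have hn' := Nat.not_odd_iff_even.mpr hn
  simp only [val_insertLast_castSucc]
  constructor
  · rintro ⟨-, hq⟩
    by_contra hlt
    obtain ⟨i, hi⟩ := exists_rank_eq r (a := n - 1) (by omega)
    have := (hq i (by split_ifs <;> omega)).2 hn
    omega
  · intro hq
    refine ⟨fun i j hij hi => ?_, fun i hi => ?_⟩
    · have h1 := h.mono (q := q - 1) (by omega) i j hij (by split_ifs at hi <;> omega)
      refine ⟨h1.1, fun hj => ?_⟩
      have := h1.2 hj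
      split_ifs <;> omega
    · exact ⟨fun h => absurd h hn', fun _ => by omega⟩

/-- An odd `n` has to be ranked below every older alternative that is ranked below the following
alternative. Ranked last, it is no obstacle and adds one more legal position. -/
theorem slack_insertLast_odd_last {n : ℕ} (hn : Odd n) (r : Pref n) :
    slack (insertLast (Fin.last n) r) = slack r + 1 := by
  refine slack_eq_of_forall _ (by have := slack_le r; omega) fun q hq => ?_
  rw [legal_insertLast]
  have hn' := Nat.not_even_iff_odd.mpr hn
  simp only [val_insertLast_castSucc, Fin.val_last, Fin.is_lt, if_true]
  constructor
  · rintro ⟨h, -⟩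
    have : n ≤ q + slack r := (legal_iff r q).mp h
    omega
  · intro h
    refine ⟨(legal_iff r q).mpr (by omega), fun i hi => ⟨fun _ => trivial, fun h => absurd h hn'⟩⟩

/-- If an odd `n` has an alternative below it, the following alternative must be ranked last. -/
theorem slack_insertLast_odd {n : ℕ} (hn : Odd n) {p : Fin (n + 1)} (hp : (p : ℕ) < n)
    (r : Pref n) : slack (insertLast p r) = 0 := by
  refine slack_eq_of_forall _ (by omega) fun q hq => ?_
  rw [legal_insertLast]
  simp only [val_insertLast_castSucc]
  constructor
  · rintro ⟨-, h⟩
    by_contra hlt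
    obtain ⟨i, hi⟩ := exists_rank_eq r (a := n - 1) (by omega)
    have := (h i (by split_ifs <;> omega)).1 hn
    omega
  · intro h
    have (i : Fin n) : (if (r i : ℕ) < p then (r i : ℕ) else r i + 1) < q := by
      have := (r i).isLt
      split_ifs <;> omega
    exact ⟨fun i j _ hi => absurd hi (this i).not_ge, fun i hi => absurd hi (this i).not_ge⟩

/-! ### Counting by slack -/

open Classical in
/-- The sum of `φ (slack r)` over all alternating orders `r` on `n` alternatives. -/
noncomputable def slackSum (n : ℕ) (φ : ℕ → ℕ) : ℕ :=
  ∑ r : Pref n with Alternating r, φ (slack r)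

theorem evenSize_eq_slackSum (n : ℕ) : evenSize n = slackSum n fun _ => 1 := by
  classical
  have : setAlternating n (evenSet n) =
      ((Finset.univ.filter fun r : Pref n => Alternating r : Finset (Pref n)) : Set (Pref n)) := by
    ext r
    simp [mem_setAlternating_evenSet]
  rw [evenSize, this, Set.ncard_coe_finset, slackSum, Finset.card_eq_sum_ones]

theorem slackSum_zero (φ : ℕ → ℕ) : slackSum 0 φ = φ 0 := by
  classical
  have h (r : Pref 0) : Alternating r := fun i => i.elim0
  have hs (r : Pref 0) : slack r = 0 := Nat.le_zero.mp (slack_le r)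
  simp [slackSum, h, hs]

open Classical in
theorem slackSum_succ_aux (n : ℕ) (φ : ℕ → ℕ) :
    slackSum (n + 1) φ = ∑ r : Pref n with Alternating r,
      ∑ p ∈ Finset.univ.filter fun p : Fin (n + 1) => Legal r p, φ (slack (insertLast p r)) := by
  unfold slackSum
  rw [Finset.sum_filter, ← (insertLast_bijective n).sum_comp, Fintype.sum_prod_type_right,
    Finset.sum_filter]
  refine Finset.sum_congr rfl fun r _ => ?_
  by_cases h : Alternating r <;> simp [alternating_insertLast, h, Finset.sum_filter]

open Classical in
/-- The legal positions are the last one and the positions `n - q` with `1 ≤ q ≤ slack r`. -/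
theorem sum_legal {n : ℕ} (r : Pref n) (g : ℕ → ℕ) (φ : Fin (n + 1) → ℕ)
    (h : ∀ p : Fin (n + 1), (p : ℕ) < n → Legal r p → φ p = g (n - p)) :
    ∑ p ∈ Finset.univ.filter fun p : Fin (n + 1) => Legal r p, φ p =
      φ (Fin.last n) + ∑ q ∈ Finset.Icc 1 (slack r), g q := by
  rw [Finset.sum_filter, Fin.sum_univ_castSucc, add_comm]
  congr 1
  · simp [legal_self]
  · rw [← Finset.sum_filter]
    refine Finset.sum_bij (fun p _ => n - p) ?_ ?_ ?_ ?_
    · intro p hp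
      have := (legal_iff r p).mp (by simpa using hp)
      simp only [Finset.mem_Icc]
      omega
    · intro p _ q _ hpq
      ext
      omega
    · intro q hq
      have := slack_le r
      rw [Finset.mem_Icc] at hq
      refine ⟨⟨n - q, by omega⟩, ?_, ?_⟩
      · simp only [Finset.mem_filter_univ, Fin.val_castSucc, legal_iff]
        omega
      · simp only
        omega
    · intro p hp
      exact h p.castSucc p.isLt (by simpa using hp)

/-- Inserting an even alternative: an order of slack `t` has successors of slacks `1` and
`1, ..., t`. -/
theorem slackSum_succ_of_even {n : ℕ} (hn : Even n) (φ : ℕ → ℕ) :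
    slackSum (n + 1) φ = slackSum n fun t => φ 1 + ∑ q ∈ Finset.Icc 1 t, φ q := by
  classical
  rw [slackSum_succ_aux, slackSum]
  refine Finset.sum_congr rfl fun r _ => ?_
  rw [sum_legal r φ, slack_insertLast_even_last hn]
  intro p hp h
  rw [slack_insertLast_even hn hp h]

/-- Inserting an odd alternative: an order of slack `s` has one successor of slack `s + 1` and `s`
successors of slack `0`. -/
theorem slackSum_succ_of_odd {n : ℕ} (hn : Odd n) (φ : ℕ → ℕ) :
    slackSum (n + 1) φ = slackSum n fun s => φ (s + 1) + s * φ 0 := by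
  classical
  rw [slackSum_succ_aux, slackSum]
  refine Finset.sum_congr rfl fun r _ => ?_
  rw [sum_legal r fun _ => φ 0, slack_insertLast_odd_last hn]
  · simp
  · intro p hp _
    rw [slack_insertLast_odd hn hp]

/-- The `s + 1` orders that come from an order of slack `s` by inserting an odd alternative have
slacks adding up to `s + 1`, hence `2 * (s + 1)` successors. -/
theorem evenSize_odd {n : ℕ} (hn : Odd n) (h3 : 3 ≤ n) : evenSize n = 2 * evenSize (n - 1) := by
  obtain ⟨m, rfl⟩ : ∃ m, n = m + 1 + 1 := ⟨n - 2, by omega⟩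
  have hm : Odd m := by grind
  rw [Nat.add_sub_cancel, evenSize_eq_slackSum, evenSize_eq_slackSum,
    slackSum_succ_of_even (by grind), slackSum_succ_of_odd hm, slackSum_succ_of_odd hm]
  simp only [slackSum, Finset.mul_sum, Finset.sum_const, Nat.card_Icc]
  refine Finset.sum_congr rfl fun r _ => ?_
  simp
  ring

/-- The number of alternating orders obtained by `m` successive insertions of two alternatives
into an alternating order of slack `t` on an even number of alternatives. -/
def descendants : ℕ → ℕ → ℕ
  | 0, _ => 1
  | m + 1, t => (descendants m 2 + descendants m 0) +
      ∑ q ∈ Finset.Icc 1 t, (descendants m (q + 1) + q * descendants m 0)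

theorem slackSum_descendants (m k : ℕ) :
    slackSum (2 * m) (descendants k) = descendants (m + k) 0 := by
  induction m generalizing k with
  | zero => simp [slackSum_zero]
  | succ m ih =>
    rw [show 2 * (m + 1) = 2 * m + 1 + 1 by ring, slackSum_succ_of_odd (by simp),
      slackSum_succ_of_even (by simp), show m + 1 + k = m + (k + 1) by ring, ← ih]
    simp [descendants]

theorem evenSize_even (m : ℕ) : evenSize (2 * m) = descendants m 0 := by
  rw [evenSize_eq_slackSum]
  exact slackSum_descendants m 0

/-! ### Generating functions -/

section GeneratingFunctions

open PowerSeries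

/-- The Catalan generating function with integer coefficients. -/
noncomputable def catalanInt : ℤ⟦X⟧ := catalanSeries.map (Nat.castRingHom ℤ)

theorem coeff_catalanInt (k : ℕ) : coeff k catalanInt = (catalan k : ℤ) := by
  simp [catalanInt]

theorem X_mul_catalanInt_sq : X * catalanInt ^ 2 = catalanInt - 1 := by
  have h := congrArg (PowerSeries.map (Nat.castRingHom ℤ)) catalanSeries_sq_mul_X_add_one
  simp only [map_add, map_mul, map_pow, map_X, map_one] at h
  change catalanInt ^ 2 * X + 1 = catalanInt at h
  linear_combination h

theorem coeff_catalanInt_sq (k : ℕ) : coeff k (catalanInt ^ 2) = (catalan (k + 1) : ℤ) := by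
  rw [← coeff_succ_X_mul, X_mul_catalanInt_sq, map_sub, coeff_catalanInt, coeff_one]
  simp

/-- The series `1 / (2 - c ^ 2)`, `c` the Catalan series. -/
noncomputable def evenSeries : ℤ⟦X⟧ := invOfUnit (2 - catalanInt ^ 2) 1

theorem evenSeries_mul : (2 - catalanInt ^ 2) * evenSeries = 1 := by
  refine mul_invOfUnit _ _ ?_
  have : constantCoeff (catalanInt ^ 2) = 1 := by
    rw [← coeff_zero_eq_constantCoeff_apply, coeff_catalanInt_sq]; simp
  have h2 : constantCoeff (2 : ℤ⟦X⟧) = 2 := map_ofNat _ 2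
  rw [map_sub, this, h2]; norm_num

/-- The generating function of `m ↦ descendants m t`, in closed form: with `W = evenSeries` and
`c = 1 + X c ^ 2` it equals `((c ^ t - 1) / X + 1 - t) * W`, and `(c ^ t - 1) / X` is
`c ^ 2 * (1 + c + ... + c ^ (t - 1))`. -/
noncomputable def descendantSeries (t : ℕ) : ℤ⟦X⟧ :=
  (catalanInt ^ 2 * ∑ i ∈ Finset.range t, catalanInt ^ i + 1 - (t : ℤ⟦X⟧)) * evenSeries

theorem descendantSeries_zero : descendantSeries 0 = evenSeries := by simp [descendantSeries]

/-- The recursion that defines `descendants`, for the closed forms. -/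
theorem descendantSeries_eq (t : ℕ) : descendantSeries t =
    1 + X * ((descendantSeries 2 + descendantSeries 0) +
      ∑ q ∈ Finset.Icc 1 t, (descendantSeries (q + 1) + (q : ℤ⟦X⟧) * descendantSeries 0)) := by
  induction t with
  | zero =>
    simp only [descendantSeries, Finset.sum_range_succ]
    simp
    linear_combination evenSeries_mul - (1 + catalanInt) * evenSeries * X_mul_catalanInt_sq
  | succ t ih =>
    rw [Finset.sum_Icc_succ_top (by omega), ← add_assoc, mul_add, ← add_assoc, ← ih,
      descendantSeries_zero]
    have hg := mul_geom_sum catalanInt (t + 2)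
    have hg' := Finset.sum_range_succ (fun i => catalanInt ^ i) t
    simp only [descendantSeries, hg']
    push_cast
    linear_combination -evenSeries * hg -
      evenSeries * (∑ i ∈ Finset.range (t + 2), catalanInt ^ i) * X_mul_catalanInt_sq

theorem coeff_descendantSeries (m t : ℕ) :
    coeff m (descendantSeries t) = (descendants m t : ℤ) := by
  induction m generalizing t with
  | zero =>
    rw [descendantSeries_eq, map_add, coeff_zero_X_mul]
    simp [descendants]
  | succ m ih =>
    rw [descendantSeries_eq, map_add, coeff_succ_X_mul, map_add, map_add, map_sum, ih, ih]
    have hq (q : ℕ) : coeff m ((q : ℤ⟦X⟧) * descendantSeries 0) = q * descendants m 0 := by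
      rw [← ih, ← nsmul_eq_mul, map_nsmul, nsmul_eq_mul]
    simp [map_add, ih, hq, descendants, coeff_one]

theorem coeff_evenSeries (m : ℕ) : coeff m evenSeries = (evenSize (2 * m) : ℤ) := by
  rw [evenSize_even, ← coeff_descendantSeries, descendantSeries_zero]

theorem evenSize_zero : evenSize 0 = 1 := evenSize_even 0

/-- The coefficient form of `(2 - c ^ 2) W = 1`, where `c ^ 2` has the coefficients
`catalan (k + 1)`; the term `k = 0` cancels one of the two copies of `evenSize (2 * m)`. -/
theorem evenSize_even_eq_sum_catalan {m : ℕ} (hm : 1 ≤ m) :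
    evenSize (2 * m) = ∑ k ∈ Finset.Icc 1 m, catalan (k + 1) * evenSize (2 * (m - k)) := by
  have h := congrArg (coeff m) evenSeries_mul
  rw [sub_mul, two_mul, map_sub, map_add, coeff_mul, coeff_one, if_neg (by omega),
    Finset.Nat.sum_antidiagonal_eq_sum_range_succ
      (fun i j => coeff i (catalanInt ^ 2) * coeff j evenSeries), Finset.sum_range_succ'] at h
  simp only [coeff_catalanInt_sq, coeff_evenSeries] at h
  have h2 : ∑ k ∈ Finset.Icc 1 m, catalan (k + 1) * evenSize (2 * (m - k)) =
      ∑ k ∈ Finset.range m, catalan (k + 1 + 1) * evenSize (2 * (m - (k + 1))) := by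
    rw [Finset.range_eq_Ico, Finset.sum_Ico_add' (fun k => catalan (k + 1) *
      evenSize (2 * (m - k)))]
    rfl
  rw [h2]
  zify
  simp at h
  linarith

/-- The coefficient form of `(1 - 4X - 4X²) W = 1 - X - 2X² - X c`, `c` the Catalan series and
`W = 1 / (2 - c²)`. -/
theorem evenSize_linear_recurrence (m : ℕ) :
    (evenSize (2 * (m + 3)) : ℤ) =
      4 * evenSize (2 * (m + 2)) + 4 * evenSize (2 * (m + 1)) - catalan (m + 2) := by
  have key : evenSeries - X * (4 * evenSeries + X * (4 * evenSeries)) =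
      1 - X * (1 + X * 2 + catalanInt) := by
    linear_combination (1 - X - 2 * X ^ 2 - X * catalanInt) * evenSeries_mul -
      evenSeries * (1 + 2 * X + catalanInt) * X_mul_catalanInt_sq
  have h := congrArg (coeff (m + 3)) key
  have h4 (k : ℕ) : coeff k (4 * evenSeries) = 4 * coeff k evenSeries := by
    have : (4 : ℤ⟦X⟧) = C 4 := rfl
    rw [this, coeff_C_mul]
  have h2 : coeff (m + 1) (2 : ℤ⟦X⟧) = 0 := by
    have : (2 : ℤ⟦X⟧) = C 2 := rfl
    rw [this, coeff_C, if_neg (by omega)]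
  simp only [map_sub, map_add, coeff_succ_X_mul, h4, h2, coeff_one, coeff_evenSeries,
    coeff_catalanInt] at h
  simp at h
  linarith

end GeneratingFunctions

/-! ### Asymptotics of the recurrence -/

/-- A contracting affine recursion with convergent inhomogeneity converges to the fixed point of
the limiting recursion. -/
theorem tendsto_of_affine_recursion {y b : ℕ → ℝ} {ρ B : ℝ} (hρ : |ρ| < 1)
    (hy : ∀ m, y (m + 1) = ρ * y m + b m) (hb : Tendsto b atTop (𝓝 B)) :
    Tendsto y atTop (𝓝 (B / (1 - ρ))) := by
  have hρ1 : 0 < 1 - ρ := by have := le_abs_self ρ; linarith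
  have hρ2 : 0 < 1 - |ρ| := by linarith
  set K := B / (1 - ρ) with hK
  have hKB : B = K - ρ * K := by rw [hK]; field_simp
  rw [Metric.tendsto_atTop]
  intro ε hε
  obtain ⟨N, hN⟩ := Metric.tendsto_atTop.mp hb (ε / 2 * (1 - |ρ|)) (by positivity)
  have hbound (k : ℕ) : |y (N + k) - K| ≤ |ρ| ^ k * |y N - K| + ε / 2 := by
    induction k with
    | zero => simp; positivity
    | succ k ih =>
      have h1 : y (N + (k + 1)) - K = ρ * (y (N + k) - K) + (b (N + k) - B) := by
        rw [← add_assoc, hy, hKB]; ring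
      have h2 := hN (N + k) (by omega)
      rw [Real.dist_eq] at h2
      calc |y (N + (k + 1)) - K| ≤ |ρ| * |y (N + k) - K| + |b (N + k) - B| := by
            rw [h1, ← abs_mul]; exact abs_add_le _ _
        _ ≤ |ρ| * (|ρ| ^ k * |y N - K| + ε / 2) + ε / 2 * (1 - |ρ|) := by gcongr
        _ = _ := by ring
  have hlim : Tendsto (fun k => |ρ| ^ k * |y N - K|) atTop (𝓝 0) := by
    simpa using (tendsto_pow_atTop_nhds_zero_of_lt_one (abs_nonneg ρ) hρ).mul_const (|y N - K|)
  obtain ⟨M, hM⟩ := Filter.eventually_atTop.mp (hlim.eventually (gt_mem_nhds (half_pos hε)))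
  refine ⟨N + M, fun n hn => ?_⟩
  obtain ⟨k, rfl⟩ := Nat.exists_eq_add_of_le hn
  have h1 := hbound (M + k)
  have h2 := hM (M + k) (by omega)
  rw [Real.dist_eq, add_assoc]
  linarith

/-- Segner's recurrence for the terms of the Catalan series. -/
theorem catalan_mul_pow_succ (x : ℝ) (k : ℕ) :
    (catalan (k + 1) : ℝ) * x ^ (k + 1) = x * ∑ ij ∈ Finset.HasAntidiagonal.antidiagonal k,
      ((catalan ij.1 : ℝ) * x ^ ij.1) * ((catalan ij.2 : ℝ) * x ^ ij.2) := by
  rw [catalan_succ', Finset.mul_sum]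
  push_cast
  rw [Finset.sum_mul]
  refine Finset.sum_congr rfl fun ij hij => ?_
  rw [← Finset.HasAntidiagonal.mem_antidiagonal.mp hij]
  ring

/-- Partial sums of the Catalan series at `x` stay below every solution `s` of `1 + x s ^ 2 ≤ s`. -/
theorem sum_catalan_mul_pow_le {x s : ℝ} (hx : 0 ≤ x) (hs : 0 ≤ s) (h : 1 + x * s ^ 2 ≤ s)
    (n : ℕ) : ∑ k ∈ Finset.range n, (catalan k : ℝ) * x ^ k ≤ s := by
  induction n with
  | zero => simpa
  | succ n ih =>
    set f : ℕ → ℝ := fun k => (catalan k : ℝ) * x ^ k with hf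
    have hf0 (k : ℕ) : 0 ≤ f k := by positivity
    have h1 (k : ℕ) : f (k + 1) = x * ∑ ij ∈ Finset.HasAntidiagonal.antidiagonal k,
        f ij.1 * f ij.2 := catalan_mul_pow_succ x k
    -- The products of total index below `n` are among those of the square of the partial sum.
    have h2 : ∑ k ∈ Finset.range n, ∑ ij ∈ Finset.HasAntidiagonal.antidiagonal k, f ij.1 * f ij.2 ≤
        (∑ k ∈ Finset.range n, f k) ^ 2 := by
      rw [sq, Finset.sum_mul_sum, ← Finset.sum_product', Finset.sum_sigma']
      refine le_trans (le_of_eq ?_) (Finset.sum_le_sum_of_subset_of_nonneg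
        (s := ((Finset.range n ×ˢ Finset.range n).filter fun ij => ij.1 + ij.2 < n))
        (Finset.filter_subset _ _) fun ij _ _ => mul_nonneg (hf0 _) (hf0 _))
      refine Finset.sum_bij (fun a _ => a.2) ?_ ?_ ?_ ?_
      · rintro ⟨k, i, j⟩ h
        simp at h ⊢
        omega
      · rintro ⟨k, i, j⟩ h ⟨k', i', j'⟩ h' heq
        simp at h h' heq ⊢
        omega
      · rintro ⟨i, j⟩ h
        simp at h
        exact ⟨⟨i + j, i, j⟩, by simp; omega, rfl⟩
      · rintro ⟨k, i, j⟩ h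
        rfl
    have h3 : 0 ≤ ∑ k ∈ Finset.range n, f k := Finset.sum_nonneg fun k _ => hf0 k
    calc ∑ k ∈ Finset.range (n + 1), f k
        = 1 + x * ∑ k ∈ Finset.range n, ∑ ij ∈ Finset.HasAntidiagonal.antidiagonal k,
            f ij.1 * f ij.2 := by
          rw [Finset.sum_range_succ', Finset.mul_sum]
          simp only [h1, add_comm]
          simp [hf]
      _ ≤ 1 + x * (∑ k ∈ Finset.range n, f k) ^ 2 := by gcongr
      _ ≤ 1 + x * s ^ 2 := by gcongr
      _ ≤ s := h

/-- The Catalan series at `(√2 - 1) / 2` is the smaller root `√2` of `s = 1 + x s ^ 2`. -/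
theorem hasSum_catalan :
    HasSum (fun k => (catalan k : ℝ) * ((√2 - 1) / 2) ^ k) √2 := by
  have h2 : √2 ^ 2 = 2 := Real.sq_sqrt (by norm_num)
  have h2' : 1 < √2 := by rw [Real.lt_sqrt] <;> norm_num
  set x : ℝ := (√2 - 1) / 2 with hx
  have hx0 : 0 < x := by rw [hx]; linarith
  set f : ℕ → ℝ := fun k => (catalan k : ℝ) * x ^ k with hf
  have hf0 (k : ℕ) : 0 ≤ f k := by positivity
  have hle := sum_catalan_mul_pow_le hx0.le (Real.sqrt_nonneg 2)
    (le_of_eq (by rw [h2, hx]; ring))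
  have hsum : Summable f := summable_of_sum_range_le hf0 hle
  have hS : ∑' k, f k ≤ √2 := Real.tsum_le_of_sum_range_le hf0 hle
  have hnorm : Summable fun k => ‖f k‖ := hsum.norm
  have hprod := tsum_mul_tsum_eq_tsum_sum_antidiagonal_of_summable_norm hnorm hnorm
  have heq : ∑' k, f k = 1 + x * (∑' k, f k) ^ 2 := by
    conv_lhs => rw [hsum.tsum_eq_zero_add]
    rw [sq, hprod, ← tsum_mul_left]
    congr 1
    · simp [hf]
    · exact tsum_congr (catalan_mul_pow_succ x)
  -- The other root of the quadratic equation is `2 + √2`, too large for the partial sums.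
  have hfac : (∑' k, f k - √2) * (∑' k, f k - (2 + √2)) = 0 := by
    linear_combination -(2 * (√2 + 1)) * heq + h2 * (1 - (∑' k, f k) ^ 2) -
      2 * (√2 + 1) * (∑' k, f k) ^ 2 * hx
  have : ∑' k, f k = √2 := by
    rcases mul_eq_zero.mp hfac with h | h <;> linarith
  exact this ▸ hsum.hasSum

/-- The asymptotics of the solutions of `w (m+3) = 4 w (m+2) + 4 w (m+1) - C (m+2)`. The roots of
the characteristic polynomial are `2 ± 2√2`, and `x = (√2 - 1) / 2` is the inverse of the larger
one. -/
theorem tendsto_of_linear_recurrence {w : ℕ → ℝ} (h1 : w 1 = 2) (h2 : w 2 = 9)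
    (hw : ∀ m, w (m + 3) = 4 * w (m + 2) + 4 * w (m + 1) - catalan (m + 2)) :
    Tendsto (fun m => w m * ((√2 - 1) / 2) ^ m) atTop (𝓝 (√2 / 4)) := by
  have hs : √2 ^ 2 = 2 := Real.sq_sqrt (by norm_num)
  have hs1 : 1 < √2 := by rw [Real.lt_sqrt] <;> norm_num
  have hs2 : √2 < 3 / 2 := by rw [Real.sqrt_lt'] <;> norm_num
  set x : ℝ := (√2 - 1) / 2 with hx
  -- Taking out the root `2 - 2√2` leaves a first-order recursion for the root `1 / x`, whose
  -- solution is a partial sum of the Catalan series.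
  have hv (m : ℕ) : (w (m + 2) - (2 - 2 * √2) * w (m + 1)) * x ^ (m + 2) =
      √2 / 2 - x * ∑ k ∈ Finset.range (m + 2), (catalan k : ℝ) * x ^ k := by
    induction m with
    | zero =>
      simp [h1, h2, Finset.sum_range_succ]
      rw [hx]
      linear_combination (√2 - 1 / 2) * hs
    | succ m ih =>
      rw [Finset.sum_range_succ, mul_add, ← sub_sub, ← ih, show m + 1 + 2 = m + 3 by ring,
        show m + 1 + 1 = m + 2 by ring, hw, pow_succ]
      linear_combination x ^ (m + 2) * w (m + 2) * ((2 + 2 * √2) * hx + hs) +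
        4 * x ^ (m + 2) * w (m + 1) * hx
  have hlim : Tendsto (fun m => (w (m + 2) - (2 - 2 * √2) * w (m + 1)) * x ^ (m + 2)) atTop
      (𝓝 (√2 / 2 - x * √2)) := by
    simp only [hv]
    exact tendsto_const_nhds.sub
      ((hasSum_catalan.tendsto_sum_nat.comp (tendsto_add_atTop_nat 2)).const_mul x)
  have hρ : |(2 - 2 * √2) * x| < 1 := by
    rw [abs_lt, hx]
    constructor <;> nlinarith
  have := tendsto_of_affine_recursion (y := fun m => w (m + 1) * x ^ (m + 1)) hρ
    (fun m => by ring) hlim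
  rw [← tendsto_add_atTop_iff_nat 1]
  convert this using 2
  rw [eq_div_iff (by have := (abs_lt.mp hρ).2; linarith), hx]
  linear_combination √2 / 4 * hs

/-! ### Peak-pit domains -/

theorem placeIn_eq_card_iff {n : ℕ} (r : Pref n) {S : Finset (Fin n)} {x : Fin n} (hx : x ∈ S) :
    placeIn r S x = S.card ↔ ∀ y ∈ S, r y ≤ r x := by
  have hS : placeIn r S x = ((S.erase x).filter fun y => r y < r x).card + 1 := by
    rw [placeIn, Finset.filter_erase, Finset.erase_eq_of_notMem (by simp)]
  rw [hS, ← Finset.card_erase_add_one hx, Nat.add_right_cancel_iff,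
    Finset.card_filter_eq_iff]
  refine ⟨fun h y hy => ?_, fun h y hy => ?_⟩
  · by_cases hyx : y = x
    · rw [hyx]
    · exact (h y (Finset.mem_erase.mpr ⟨hyx, hy⟩)).le
  · have hy' := Finset.mem_erase.mp hy
    exact (h y hy'.2).lt_of_ne fun he => hy'.1 (r.injective he)

theorem card_filter_lt_add_card_filter_gt {n m : ℕ} (P : Fin m → Pref n) {x y : Fin n}
    (hxy : x ≠ y) :
    (Finset.univ.filter fun i => P i x < P i y).card +
      (Finset.univ.filter fun i => P i y < P i x).card = m := by
  have hc := Finset.card_filter_add_card_filter_not (s := Finset.univ)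
    (fun i : Fin m => P i x < P i y)
  have he : (Finset.univ.filter fun i => ¬ P i x < P i y) =
      Finset.univ.filter fun i => P i y < P i x := by
    refine Finset.filter_congr fun i _ => ?_
    rw [not_lt, le_iff_lt_or_eq, or_iff_left fun he => hxy ((P i).injective he).symm]
  rwa [he, Finset.card_univ, Fintype.card_fin] at hc

/-- Two majorities of the same profile have a common voter. -/
theorem exists_of_majority {n m : ℕ} {P : Fin m → Pref n} {x y z w : Fin n}
    (h : Majority P x y) (h' : Majority P z w) : ∃ i, P i x < P i y ∧ P i z < P i w := by
  have key {x y : Fin n} (h : Majority P x y) :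
      m < 2 * (Finset.univ.filter fun i => P i x < P i y).card := by
    have hxy : x ≠ y := by rintro rfl; simp [Majority] at h
    have hc := card_filter_lt_add_card_filter_gt P hxy
    unfold Majority at h
    omega
  by_contra! hno
  have hd : Disjoint (Finset.univ.filter fun i => P i x < P i y)
      (Finset.univ.filter fun i => P i z < P i w) := by
    rw [Finset.disjoint_filter]
    exact fun i _ hi => (hno i hi).not_gt
  have hle := (Finset.card_union_of_disjoint hd).symm.trans_le (Finset.card_le_univ _)
  rw [Fintype.card_fin] at hle
  have := key h
  have := key h'
  omega

theorem majority_or_majority {n m : ℕ} (hm : Odd m) (P : Fin m → Pref n) {x y : Fin n}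
    (hxy : x ≠ y) : Majority P x y ∨ Majority P y x := by
  have hc := card_filter_lt_add_card_filter_gt P hxy
  unfold Majority
  have := Nat.odd_iff.mp hm
  omega

/-- A majority cycle on `x, y, z` provides, for each pair of consecutive majorities, a common
voter; the three voters together rank each of `x, y, z` first once and last once. -/
theorem IsPeakPit.isCondorcet {n : ℕ} {D : Domain n} (hD : IsPeakPit D) : IsCondorcet D := by
  intro m P hm hP x y z hxy hyz
  have ne_of {a b : Fin n} (h : Majority P a b) : a ≠ b := by
    rintro rfl
    simp [Majority] at h
  have hxz : x ≠ z := by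
    rintro rfl
    exact absurd hxy (not_lt.mpr (le_of_lt hyz))
  refine (majority_or_majority hm P hxz).resolve_right fun hzx => ?_
  obtain ⟨i, hi1, hi2⟩ := exists_of_majority hxy hyz
  obtain ⟨j, hj1, hj2⟩ := exists_of_majority hyz hzx
  obtain ⟨k, hk1, hk2⟩ := exists_of_majority hzx hxy
  have hS : ({x, y, z} : Finset (Fin n)).card = 3 :=
    Finset.card_eq_three.mpr ⟨x, y, z, ne_of hxy, hxz, ne_of hyz, rfl⟩
  have hi := hi1.trans hi2
  have hj := hj1.trans hj2
  have hk := hk1.trans hk2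
  rcases hD {x, y, z} hS with ⟨a, ha, h⟩ | ⟨a, ha, h⟩
  · have h' (l : Fin m) := h (P l) (hP l)
    rw [← hS] at h'
    simp only [Ne, placeIn_eq_card_iff _ ha] at h'
    simp only [Finset.mem_insert, Finset.mem_singleton, forall_eq_or_imp, forall_eq] at h' ha
    rcases ha with rfl | rfl | rfl
    · exact h' j ⟨le_rfl, hj.le, hj2.le⟩
    · exact h' k ⟨hk2.le, le_rfl, hk.le⟩
    · exact h' i ⟨hi.le, hi2.le, le_rfl⟩
  · have h' (l : Fin m) := h (P l) (hP l)
    simp only [Ne, placeIn_eq_one] at h'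
    simp only [Finset.mem_insert, Finset.mem_singleton, forall_eq_or_imp, forall_eq] at h' ha
    rcases ha with rfl | rfl | rfl
    · exact h' i ⟨le_rfl, hi1.le, hi.le⟩
    · exact h' j ⟨hj.le, le_rfl, hj1.le⟩
    · exact h' k ⟨hk1.le, hk.le, le_rfl⟩

theorem isPeakPit_setAlternating (n : ℕ) (A : Set ℕ) : IsPeakPit (setAlternating n A) := by
  intro S hS
  have hmem (a : Fin 3) : S.orderEmbOfFin hS a ∈ S := S.orderEmbOfFin_mem hS a
  set i := S.orderEmbOfFin hS 0
  set j := S.orderEmbOfFin hS 1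
  set k := S.orderEmbOfFin hS 2
  have hij : i < j := (S.orderEmbOfFin hS).strictMono (by decide)
  have hjk : j < k := (S.orderEmbOfFin hS).strictMono (by decide)
  have hS' : S = {i, j, k} := by
    symm
    refine Finset.eq_of_subset_of_card_le ?_ ?_
    · simp only [Finset.insert_subset_iff, Finset.singleton_subset_iff]
      exact ⟨hmem 0, hmem 1, hmem 2⟩
    · rw [hS, Finset.card_eq_three.mpr ⟨i, j, k, hij.ne, (hij.trans hjk).ne, hjk.ne, rfl⟩]
  by_cases hj : (j : ℕ) + 1 ∈ A
  · exact Or.inl ⟨i, hmem 0, fun r hr => hS' ▸ (hr i j k hij hjk).1 hj⟩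
  · exact Or.inr ⟨k, hmem 2, fun r hr => hS' ▸ (hr i j k hij hjk).2 hj⟩

theorem evenSize_le_maxPeakPit (n : ℕ) : evenSize n ≤ maxPeakPit n :=
  (isGreatest_maxPeakPit n).2 ⟨_, (isPeakPit_setAlternating n _).isCondorcet,
    isPeakPit_setAlternating n _, rfl⟩

theorem maxPeakPit_le_maxCondorcet (n : ℕ) : maxPeakPit n ≤ maxCondorcet n := by
  obtain ⟨D, hD, -, h⟩ := (isGreatest_maxPeakPit n).1
  exact (isGreatest_maxCondorcet n).2 ⟨D, hD, h⟩

/-! ### Asymptotics of the domain sizes -/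

theorem InOmega.mono_left {u u' v : ℕ → ℝ} (h : InOmega u v) (hu : ∀ n, u n ≤ u' n) :
    InOmega u' v := by
  obtain ⟨c, hc, h⟩ := h
  exact ⟨c, hc, h.mono fun n hn => hn.trans (hu n)⟩

theorem InOmega.mono_right {u v v' : ℕ → ℝ} (h : InOmega u v) (hv : ∀ n, v' n ≤ v n) :
    InOmega u v' := by
  obtain ⟨c, hc, h⟩ := h
  exact ⟨c, hc, h.mono fun n hn => (mul_le_mul_of_nonneg_left (hv n) hc.le).trans hn⟩

theorem sqrt_two_add_pow_two_mul (m : ℕ) : √(2 + 2 * √2) ^ (2 * m) = (2 + 2 * √2) ^ m := by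
  rw [pow_mul, Real.sq_sqrt (by positivity)]

theorem tendsto_evenSize_even :
    Tendsto (fun m : ℕ => (evenSize (2 * m) : ℝ) / (2 + 2 * √2) ^ m) atTop (𝓝 (√2 / 4)) := by
  have hs : √2 ^ 2 = 2 := Real.sq_sqrt (by norm_num)
  have h1 : evenSize (2 * 1) = 2 := by rw [evenSize_even]; rfl
  have h2 : evenSize (2 * 2) = 9 := by
    rw [evenSize_even_eq_sum_catalan (by norm_num)]
    simp [Finset.sum_Icc_succ_top, h1, evenSize_zero, catalan_two, catalan_three]
  have h := tendsto_of_linear_recurrence (w := fun m => (evenSize (2 * m) : ℝ))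
    (by rw [h1]; norm_num) (by rw [h2]; norm_num)
    (fun m => by exact_mod_cast evenSize_linear_recurrence m)
  refine h.congr fun m => ?_
  have hx : (√2 - 1) / 2 = (2 + 2 * √2)⁻¹ := by
    refine eq_inv_of_mul_eq_one_left ?_
    linear_combination hs
  rw [hx, inv_pow, div_eq_mul_inv]

theorem evenSize_isEquivalent_even :
    (fun m : ℕ => (evenSize (2 * m) : ℝ)) ~[atTop]
      fun m : ℕ => √2 / 4 * √(2 + 2 * √2) ^ (2 * m) := by
  simp only [sqrt_two_add_pow_two_mul]
  have h0 : √2 / 4 ≠ 0 := by positivity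
  rw [isEquivalent_iff_tendsto_one (Eventually.of_forall fun m => by positivity)]
  have := tendsto_evenSize_even.div_const (√2 / 4)
  rw [div_self h0] at this
  refine this.congr fun m => ?_
  simp only [Pi.div_apply]
  field_simp

/-- The odd case follows from `evenSize_odd` and `√(√2 - 1) * √(2 + 2√2) = √2`. -/
theorem evenSize_isEquivalent_odd :
    (fun m : ℕ => (evenSize (2 * m + 1) : ℝ)) ~[atTop]
      fun m : ℕ => √(√2 - 1) / 2 * √(2 + 2 * √2) ^ (2 * m + 1) := by
  have hs : √2 ^ 2 = 2 := Real.sq_sqrt (by norm_num)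
  have hs1 : 1 < √2 := by rw [Real.lt_sqrt] <;> norm_num
  have hr : √(√2 - 1) * √(2 + 2 * √2) = √2 := by
    rw [← Real.sqrt_mul (by linarith)]
    congr 1
    linear_combination 2 * hs
  have hv (m : ℕ) : √(√2 - 1) / 2 * √(2 + 2 * √2) ^ (2 * m + 1) =
      2 * (√2 / 4 * √(2 + 2 * √2) ^ (2 * m)) := by
    rw [pow_succ]
    linear_combination (√(2 + 2 * √2) ^ (2 * m) / 2) * hr
  simp only [hv]
  have h := (IsEquivalent.refl (u := fun _ : ℕ => (2 : ℝ))).mul evenSize_isEquivalent_even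
  refine h.congr_left ?_
  filter_upwards [eventually_ge_atTop 1] with m hm
  simp only [Pi.mul_apply]
  rw [evenSize_odd (n := 2 * m + 1) (by simp) (by omega), Nat.add_sub_cancel]
  push_cast
  rfl

theorem inOmega_evenSize : InOmega (fun n => (evenSize n : ℝ)) (fun n => √(2 + 2 * √2) ^ n) := by
  have hs1 : 1 < √2 := by rw [Real.lt_sqrt] <;> norm_num
  have hhalf {u v : ℕ → ℝ} (h : u ~[atTop] v) (hv : ∀ m, 0 < v m) :
      ∀ᶠ m in atTop, 1 / 2 * v m ≤ u m := by
    have := (isEquivalent_iff_tendsto_one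
      (Eventually.of_forall fun m => (hv m).ne')).mp h
    filter_upwards [this.eventually (lt_mem_nhds (by norm_num : (1 / 2 : ℝ) < 1))] with m hm
    rw [Pi.div_apply, lt_div_iff₀ (hv m)] at hm
    exact hm.le
  have hp : 0 < √(√2 - 1) := Real.sqrt_pos.mpr (by linarith)
  have he := hhalf evenSize_isEquivalent_even fun m => by positivity
  have ho := hhalf evenSize_isEquivalent_odd fun m => by positivity
  obtain ⟨N, hN⟩ := eventually_atTop.mp (he.and ho)
  refine ⟨min (1 / 2 * (√2 / 4)) (1 / 2 * (√(√2 - 1) / 2)), by positivity, ?_⟩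
  filter_upwards [eventually_ge_atTop (2 * N + 1)] with n hn
  rcases Nat.even_or_odd' n with ⟨m, rfl | rfl⟩
  · refine le_trans ?_ (hN m (by omega)).1
    rw [← mul_assoc]
    gcongr
    exact min_le_left _ _
  · refine le_trans ?_ (hN m (by omega)).2
    rw [← mul_assoc]
    gcongr
    exact min_le_right _ _

theorem le_sqrt_two_add : (2.1973 : ℝ) ≤ √(2 + 2 * √2) := by
  have : (1.41421 : ℝ) ≤ √2 := by rw [Real.le_sqrt] <;> norm_num
  rw [Real.le_sqrt' (by norm_num)]
  norm_num
  linarith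

end VotingDomain

theorem mainTheorem1 :
    -- asymptotics for even `n`
    ((fun m : ℕ => (evenSize (2 * m) : ℝ)) ~[atTop]
        fun m : ℕ => √2 / 4 * √(2 + 2 * √2) ^ (2 * m)) ∧
    -- asymptotics for odd `n`
    ((fun m : ℕ => (evenSize (2 * m + 1) : ℝ)) ~[atTop]
        fun m : ℕ => √(√2 - 1) / 2 * √(2 + 2 * √2) ^ (2 * m + 1)) ∧
    -- the sizes for odd `n ≥ 3` are twice the preceding ones
    (∀ n : ℕ, Odd n → 3 ≤ n → evenSize n = 2 * evenSize (n - 1)) ∧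
    -- the recurrence with Catalan numbers for even `n`
    (evenSize 0 = 1 ∧ ∀ m : ℕ, 1 ≤ m →
      evenSize (2 * m) = ∑ k ∈ Finset.Icc 1 m, catalan (k + 1) * evenSize (2 * (m - k))) ∧
    -- lower bounds for the largest Condorcet and peak-pit domains
    InOmega (fun n => (maxCondorcet n : ℝ)) (fun n => √(2 + 2 * √2) ^ n) ∧
    InOmega (fun n => (maxPeakPit n : ℝ)) (fun n => √(2 + 2 * √2) ^ n) ∧
    InOmega (fun n => (maxCondorcet n : ℝ)) (fun n => (2.1973 : ℝ) ^ n) ∧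
    InOmega (fun n => (maxPeakPit n : ℝ)) (fun n => (2.1973 : ℝ) ^ n) := by
  have hp : InOmega (fun n => (maxPeakPit n : ℝ)) (fun n => √(2 + 2 * √2) ^ n) :=
    inOmega_evenSize.mono_left fun n => by exact_mod_cast evenSize_le_maxPeakPit n
  have hc : InOmega (fun n => (maxCondorcet n : ℝ)) (fun n => √(2 + 2 * √2) ^ n) :=
    hp.mono_left fun n => by exact_mod_cast maxPeakPit_le_maxCondorcet n
  have hle (n : ℕ) : (2.1973 : ℝ) ^ n ≤ √(2 + 2 * √2) ^ n :=
    pow_le_pow_left₀ (by norm_num) le_sqrt_two_add n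
  exact ⟨evenSize_isEquivalent_even, evenSize_isEquivalent_odd, fun _ => evenSize_odd,
    ⟨evenSize_zero, fun _ => evenSize_even_eq_sum_catalan⟩, hc, hp, hc.mono_right hle,
    hp.mono_right hle⟩
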